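/- **Setting.** One grant-based user with channel coefficient $g$ and $M\ge 2$ grant-free users with channel coefficients $h_1,\dots,h_M$ share a resource block (noise power one, Rayleigh fading): $g,h_1,\dots,h_M$ are independent circularly symmetric complex Gaussian random variables with mean $0$ and $\mathbb E|\cdot|^2=1$, so that $|g|^2,|h_1|^2,\dots,|h_M|^2$ are i.i.d. exponential with mean one. Let $P_0,P_s>0$ be the transmit powers of the grant-based user and of each grant-free user, and $R_0>0$, $R_s\ge 0$ their target rates (in bits). Put $\epsilon_0=2^{R_0}-1$, $\epsilon_s=2^{R_s}-1$ and assume $\epsilon_s\epsilon_0<1$. **Scheme.** The base station broadcasts $\tau(|g|^2)=\max\{0,\,P_0|g|^2/\epsilon_0-1\}$. If admitted, user $k$ has rate $R_{k,I}=\log_2(1+P_s|h_k|^2)$ when $P_s|h_k|^2<\tau(|g|^2)$ (Group 2), and rate $R_{k,II}=\log_2\!\big(1+\frac{P_s|h_k|^2}{P_0|g|^2+1}\big)$ otherwise (Group 1; equality in the threshold has probability zero). Distributed contention admits a user for which this rate is largest. Let $\mathrm P_{out}$ be the probability that the rate of the admitted user is smaller than $R_s$. **Theorem.** Let $\alpha_0=\frac{\epsilon_0}{P_0}$,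 $\alpha_s=\frac{\epsilon_s}{P_s}$, $\alpha_1=(1+\epsilon_s)\alpha_0$, $\alpha_2=\frac{\epsilon_0(\epsilon_s+1)}{(1-\epsilon_0\epsilon_s)P_0}$, $$g_\mu(x_1,x_2)=\frac{e^{-(1+\mu)x_1}-e^{-(1+\mu)x_2}}{1+\mu},\qquad \phi(p,\mu)=e^{-p\alpha_s}g_\mu(\alpha_1,\alpha_2)+e^{p/P_s}g_{\mu+\frac{p}{P_s\alpha_0}}(\alpha_0,\alpha_1),$$ $\bar\eta_m=\frac{M!}{m!(M-m)!}$, $\tilde\eta_0=\frac{M!}{(M-2)!}$, $\tilde\mu_2=l\alpha_sP_0+(M-m-l)\frac{\epsilon_0^{-1}P_0}{P_s}$, $\tilde\mu_4=e^{-l\alpha_s+(M-m-l)\frac1{P_s}}$, $\mu_7=\frac1{P_s\alpha_0}$, $\mu_8=\alpha_sP_0$, $\tilde\mu_{12}=l\alpha_sP_0+(M-l)\frac{\alpha_0^{-1}}{P_s}$. Then $$\begin{aligned}\mathrm P_{out}=&\sum_{m=1}^{M-2}\bar\eta_m\sum_{l=0}^{M-m}\binom{M-m}{l}(-1)^l\sum_{p=0}^m\binom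 mp(-1)^p\tilde\mu_4\,\phi(p,\tilde\mu_2)\\&+\sum_{i=0}^{M-1}\binom{M-1}{i}\frac{(-1)^i\tilde\eta_0}{M-1}\Big(e^{1/P_s}\phi(i,\mu_7)-e^{-\alpha_s}\phi(i,\mu_8)\Big)\\&+\frac{\tilde\eta_0}{M(M-1)}\sum_{l=0}^M(-1)^l\binom Ml e^{-l\alpha_s}e^{\frac{M-l}{P_s}}g_{\tilde\mu_{12}}(\alpha_0,\alpha_2)+\sum_{i=0}^M\binom Mi(-1)^ie^{i/P_s}g_{\frac{i}{\alpha_0P_s}}(\alpha_0,\alpha_1)\\&+(1-e^{-\alpha_s})^Me^{-\alpha_1}+\sum_{i=0}^M\binom Mi(-1)^ie^{-i\alpha_s}\frac{1-e^{-(1+i\alpha_sP_0)\alpha_0}}{1+i\alpha_sP_0}.\end{aligned}$$ -/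

import Mathlib

open MeasureTheory ProbabilityTheory

open scoped Nat

noncomputable section

namespace SGF

/-- The standard circularly symmetric complex Gaussian law `CN(0,1)` (Rayleigh fading): the real
and imaginary parts are independent, real Gaussian, with mean `0` and variance `1/2` each, so that
the mean is `0` and `E|z|² = 1`. -/
def complexGaussian : Measure ℂ :=
  ((gaussianReal 0 (1 / 2)).prod (gaussianReal 0 (1 / 2))).map Complex.measurableEquivRealProd.symm

/-- The parameters of a semi-grant-free (SGF) uplink; the noise power is normalized to one. -/
structure Params where
  /-- transmit power of the grant-based user -/
  P₀ : ℝ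
  /-- common transmit power of the grant-free users -/
  Ps : ℝ
  /-- target data rate of the grant-based user, in bits per channel use -/
  R₀ : ℝ
  /-- common target data rate of the grant-free users, in bits per channel use -/
  Rs : ℝ

namespace Params

variable (S : Params)

/-! ### The transmission scheme -/

/-- The threshold `τ(|g|²)` broadcast by the base station, as a function of `x = |g|²`. -/
def τ (x : ℝ) : ℝ := max 0 (S.P₀ * x / ((2 : ℝ) ^ S.R₀ - 1) - 1)

/-- `R_{k,I}`: rate of a grant-free user with power gain `y = |h_k|²` that is decoded in the second
stage of successive interference cancellation, free of interference. -/
def rateI (y : ℝ) : ℝ := Real.logb 2 (1 + S.Ps * y)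

/-- `R_{k,II}`: rate of a grant-free user with power gain `y = |h_k|²` that is decoded in the first
stage, treating the signal of the grant-based user (power gain `x = |g|²`) as noise. -/
def rateII (x y : ℝ) : ℝ := Real.logb 2 (1 + S.Ps * y / (S.P₀ * x + 1))

open Classical in
/-- Rate of a grant-free user if it is granted access: `R_{k,I}` if it lies in Group 2, that is
`P_s |h_k|² < τ(|g|²)`, and `R_{k,II}` if it lies in Group 1, that is `P_s |h_k|² > τ(|g|²)`
(a user exactly at the threshold, an event of probability zero, is counted in Group 1).
The backoff time of the user is inversely proportional to this rate. -/
def rate (x y : ℝ) : ℝ := if S.Ps * y < S.τ x then S.rateI y else S.rateII x y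

/-- User `k` is admitted by the contention, for the channel coefficients `g` (grant-based user) and
`h` (grant-free users): its backoff time is the shortest, i.e. its rate is the largest. -/
def IsAdmitted {M : ℕ} (g : ℂ) (h : Fin M → ℂ) (k : Fin M) : Prop :=
  ∀ j, S.rate (‖g‖ ^ 2) (‖h j‖ ^ 2) ≤ S.rate (‖g‖ ^ 2) (‖h k‖ ^ 2)

/-! ### Quantities in the closed form -/

def ε₀ : ℝ := (2 : ℝ) ^ S.R₀ - 1

def εs : ℝ := (2 : ℝ) ^ S.Rs - 1

def α₀ : ℝ := S.ε₀ / S.P₀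

def αs : ℝ := S.εs / S.Ps

def α₁ : ℝ := (1 + S.εs) * S.α₀

def α₂ : ℝ := S.ε₀ * (S.εs + 1) / ((1 - S.ε₀ * S.εs) * S.P₀)

/-- `g_μ(x₁, x₂)`. -/
def gAux (μ x₁ x₂ : ℝ) : ℝ :=
  (Real.exp (-(1 + μ) * x₁) - Real.exp (-(1 + μ) * x₂)) / (1 + μ)

/-- `φ(p, μ)`. -/
def phi (p : ℕ) (μ : ℝ) : ℝ :=
  Real.exp (-p * S.αs) * gAux μ S.α₁ S.α₂
    + Real.exp (p / S.Ps) * gAux (μ + p / (S.Ps * S.α₀)) S.α₀ S.α₁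

/-- `η̄_m`. -/
def ηbar (M m : ℕ) : ℝ := (M ! : ℝ) / ((m ! : ℝ) * ((M - m)! : ℝ))

/-- `η̃₀`. -/
def ηtilde (M : ℕ) : ℝ := (M ! : ℝ) / ((M - 2)! : ℝ)

/-- `μ̃₂`. -/
def μ₂ (M m l : ℕ) : ℝ :=
  l * S.αs * S.P₀ + ((M : ℝ) - m - l) * (S.ε₀⁻¹ * S.P₀ / S.Ps)

/-- `μ̃₄`. -/
def μ₄ (M m l : ℕ) : ℝ := Real.exp (-l * S.αs + ((M : ℝ) - m - l) * (1 / S.Ps))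

def μ₇ : ℝ := 1 / (S.Ps * S.α₀)

def μ₈ : ℝ := S.αs * S.P₀

/-- `μ̃₁₂`. -/
def μ₁₂ (M l : ℕ) : ℝ := l * S.αs * S.P₀ + ((M : ℝ) - l) * (S.α₀⁻¹ / S.Ps)

end Params

end SGF

end

/-!
The admitted user has the largest rate, so it misses the target exactly when all `M` grant-free
users do (`rate_lt_iff_forall_of_isAdmitted`). The power gains are i.i.d. exponential with mean one
(`map_sq_norm_complexGaussian`, by polar coordinates), so conditioning on the gain `x` of the
grant-based user turns the outage probability into the mean of `F(x) ^ M`, where `F = missProb` is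
the probability that one user misses the target (`measureReal_forall_rate_lt`).

A user misses the target if it lies in Group 2 with gain below `min (τ(x) / P_s) α_s`, or in Group 1
with gain between `τ(x) / P_s` and `α_s (P₀ x + 1)`. With `a(x) = thresholdTail`,
`b(x) = targetTail` and `c = exp (-α_s)`, this gives `F = 1 - b` on `[0, α₁]`,
`F = (1 - c) + (a - b)` on `[α₁, α₂]`, and `F = 1 - c` beyond `α₂`, where Group 1 no longer
contributes. On `[α₀, α₁]` one writes `1 - b = (1 - a) + (a - b)` to separate the two groups there
too.

The closed form is what the binomial theorem makes of these integrals. Expanding the `M`-th power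
on `[α₀, α₂]` by the number `m` of users in Group 2 gives `∑ m, M.choose m * groupTerm M m`
(`sum_choose_mul_groupTerm`); the cases `1 ≤ m ≤ M - 2`, `m = M - 1` and `m = 0` are the first three
sums of the closed form. The case `m = M`, joined with the tail beyond `α₂`, gives the fourth and
the fifth term, and `[0, α₀]` the last. Each integral becomes an alternating sum of values of
`gAux`, the integral of an exponential, by expanding the powers of `1 - a`, `1 - c` and `a - b`
(`sum_choose_mul_integral`).
-/

noncomputable section

/-! ### Rayleigh fading and independence -/

namespace SGF

open Set

theorem gaussianPDF_half_mul (x y : ℝ) :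
    gaussianPDF 0 (1 / 2) x * gaussianPDF 0 (1 / 2) y =
      ENNReal.ofReal (Real.exp (-(x ^ 2 + y ^ 2)) / Real.pi) := by
  rw [gaussianPDF, gaussianPDF, ← ENNReal.ofReal_mul (gaussianPDFReal_nonneg _ _ _)]
  congr 1
  have h2 : (2 * Real.pi * (((1 / 2 : NNReal)) : ℝ)) = Real.pi := by push_cast; ring
  simp only [gaussianPDFReal, h2]
  rw [mul_mul_mul_comm, ← Real.exp_add, ← mul_inv, Real.mul_self_sqrt Real.pi_pos.le]
  rw [div_eq_inv_mul (Real.exp (-(x ^ 2 + y ^ 2)))]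
  congr 2
  push_cast
  ring

theorem lintegral_complexGaussian {f : ℂ → ENNReal} (hf : Measurable f) :
    ∫⁻ z, f z ∂complexGaussian =
      ∫⁻ z : ℂ, ENNReal.ofReal (Real.exp (-‖z‖ ^ 2) / Real.pi) * f z := by
  have hv : (1 / 2 : NNReal) ≠ 0 := by norm_num
  rw [complexGaussian, lintegral_map hf (MeasurableEquiv.measurable _),
    gaussianReal_of_var_ne_zero _ hv,
    prod_withDensity (measurable_gaussianPDF _ _) (measurable_gaussianPDF _ _),
    lintegral_withDensity_eq_lintegral_mul _ (by fun_prop)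
      (g := fun a => f (Complex.measurableEquivRealProd.symm a))
      (hf.comp (MeasurableEquiv.measurable _)), ← Measure.volume_eq_prod,
    ← Complex.volume_preserving_equiv_real_prod.lintegral_comp_emb
      Complex.measurableEquivRealProd.measurableEmbedding]
  refine lintegral_congr fun z => ?_
  simp only [Pi.mul_apply, gaussianPDF_half_mul, MeasurableEquiv.symm_apply_apply]
  rw [Complex.sq_norm, Complex.normSq_apply, Complex.measurableEquivRealProd_apply]
  simp only [sq]

instance : IsProbabilityMeasure complexGaussian :=
  Measure.isProbabilityMeasure_map (MeasurableEquiv.measurable _).aemeasurable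

/-- Under Rayleigh fading the power gain is exponential with mean one. -/
theorem map_sq_norm_complexGaussian :
    complexGaussian.map (fun z => ‖z‖ ^ 2) = expMeasure 1 := by
  have hm : Measurable (fun z : ℂ => ‖z‖ ^ 2) := by fun_prop
  have := isProbabilityMeasure_expMeasure one_pos
  have : IsProbabilityMeasure (complexGaussian.map (fun z => ‖z‖ ^ 2)) :=
    Measure.isProbabilityMeasure_map hm.aemeasurable
  refine Measure.eq_of_cdf _ _ ?_
  ext t
  rw [cdf_expMeasure_eq one_pos, cdf_eq_real, measureReal_def,
    Measure.map_apply hm measurableSet_Iic]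
  split_ifs with ht
  swap
  · have : (fun z : ℂ => ‖z‖ ^ 2) ⁻¹' Iic t = ∅ := by
      ext z
      simp only [mem_preimage, mem_Iic, mem_empty_iff_false, iff_false]
      nlinarith [sq_nonneg ‖z‖]
    simp [this]
  rw [← lintegral_indicator_one (hm measurableSet_Iic),
    lintegral_complexGaussian (measurable_one.indicator (hm measurableSet_Iic)),
    ← Complex.lintegral_comp_polarCoord_symm]
  have e1 : ∀ p ∈ polarCoord.target, ENNReal.ofReal p.1 • (ENNReal.ofReal
        (Real.exp (-‖Complex.polarCoord.symm p‖ ^ 2) / Real.pi) *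
        ((fun z : ℂ => ‖z‖ ^ 2) ⁻¹' Iic t).indicator 1 (Complex.polarCoord.symm p)) =
      (Iic (√t)).indicator
        (fun r => ENNReal.ofReal (r * (Real.exp (-r ^ 2) / Real.pi))) p.1 := by
    intro p hp
    have hp0 : 0 < p.1 := hp.1
    have hiff : p.1 ^ 2 ≤ t ↔ p.1 ≤ √t := (Real.le_sqrt hp0.le ht).symm
    by_cases h : p.1 ≤ √t
    · rw [indicator_of_mem (by simpa [abs_of_pos hp0] using hiff.2 h),
        indicator_of_mem (by simpa using h), ENNReal.ofReal_mul hp0.le]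
      simp [abs_of_pos hp0]
    · rw [indicator_of_notMem (by simpa [abs_of_pos hp0] using fun h' => h (hiff.1 h')),
        indicator_of_notMem (by simpa using h)]
      simp
  rw [setLIntegral_congr_fun polarCoord.open_target.measurableSet e1]
  have hmI : Measurable ((Iic (√t)).indicator
        (fun r => ENNReal.ofReal (r * (Real.exp (-r ^ 2) / Real.pi)))) :=
    Measurable.indicator (by fun_prop) measurableSet_Iic
  rw [polarCoord_target, Measure.volume_eq_prod, ← Measure.prod_restrict,
    lintegral_prod (fun x : ℝ × ℝ => (Iic (√t)).indicator
        (fun r => ENNReal.ofReal (r * (Real.exp (-r ^ 2) / Real.pi))) x.1)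
      (hmI.comp measurable_fst).aemeasurable]
  simp only [lintegral_const, Measure.restrict_apply MeasurableSet.univ, univ_inter,
    Real.volume_Ioo]
  rw [lintegral_mul_const _ hmI, lintegral_indicator measurableSet_Iic,
    Measure.restrict_restrict measurableSet_Iic, inter_comm, Ioi_inter_Iic,
    ← ofReal_integral_eq_lintegral_ofReal, ← intervalIntegral.integral_of_le (Real.sqrt_nonneg t),
    ← ENNReal.ofReal_mul', ENNReal.toReal_ofReal]
  · have hd : ∀ x ∈ uIcc 0 (√t), HasDerivAt (fun r => -Real.exp (-r ^ 2) / (2 * Real.pi))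
        (x * (Real.exp (-x ^ 2) / Real.pi)) x := by
      intro x _
      have := (((hasDerivAt_pow 2 x).neg.exp).neg).div_const (2 * Real.pi)
      refine this.congr_deriv ?_
      simp only [Pi.neg_apply]
      field_simp
      simp [mul_comm]
    rw [intervalIntegral.integral_eq_sub_of_hasDerivAt hd
      (Continuous.intervalIntegrable (by fun_prop) _ _), Real.sq_sqrt ht]
    field_simp
    simp
    ring
  · refine mul_nonneg (intervalIntegral.integral_nonneg (Real.sqrt_nonneg t) fun r hr => ?_) ?_
    · have := hr.1; positivity
    · linarith [Real.pi_pos]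
  · linarith [Real.pi_pos]
  · exact (Continuous.integrableOn_Icc (by fun_prop)).mono_set Ioc_subset_Icc_self
  · filter_upwards [ae_restrict_mem measurableSet_Ioc] with r hr
    have := hr.1
    simp only [Pi.zero_apply]
    positivity

/-- If the variables `X o` are i.i.d. with law `ν`, then given `X none = x` the events
`(x, X (some j)) ∈ A` are independent with equal probabilities. -/
theorem measure_forall_mem_eq_lintegral_pow {Ω : Type*} [MeasurableSpace Ω] {P : Measure Ω}
    [IsProbabilityMeasure P] {M : ℕ} {X : Option (Fin M) → Ω → ℝ} (hX : iIndepFun X P)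
    {ν : Measure ℝ} [IsProbabilityMeasure ν] (hlaw : ∀ o, HasLaw (X o) ν P)
    {A : Set (ℝ × ℝ)} (hA : MeasurableSet A) :
    P {ω | ∀ j, (X none ω, X (some j) ω) ∈ A} = ∫⁻ x, ν {y | (x, y) ∈ A} ^ M ∂ν := by
  have hmeas : ∀ o, AEMeasurable (X o) P := fun o => (hlaw o).aemeasurable
  have hind : IndepFun (X none) (fun ω (j : Fin M) => X (some j) ω) P := by
    have h := hX.indepFun_finset₀ {none} (Finset.univ.erase none) (by simp) hmeas
    have h₁ : Measurable fun u : ↥({none} : Finset (Option (Fin M))) → ℝ =>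
        u ⟨none, by simp⟩ := by fun_prop
    have h₂ : Measurable fun u : ↥(Finset.univ.erase none : Finset (Option (Fin M))) → ℝ =>
        fun j : Fin M => u ⟨some j, by simp⟩ := by fun_prop
    exact h.comp h₁ h₂
  have hpi : P.map (fun ω (j : Fin M) => X (some j) ω) = Measure.pi fun _ => ν := by
    have h := hX.precomp (Option.some_injective (Fin M))
    rw [iIndepFun_iff_map_fun_eq_pi_map (fun j => hmeas _)] at h
    refine h.trans ?_
    congr 1
    ext1 j
    exact (hlaw (some j)).map_eq
  have hjm : AEMeasurable (fun ω (j : Fin M) => X (some j) ω) P :=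
    aemeasurable_pi_lambda _ fun j => hmeas _
  have hjoint := hind.map_prod_eq_prod_map_map (hmeas _) hjm
  rw [hpi, (hlaw none).map_eq] at hjoint
  have hB : MeasurableSet {q : ℝ × (Fin M → ℝ) | ∀ j, (q.1, q.2 j) ∈ A} := by
    rw [ofPred_forall]
    exact MeasurableSet.iInter fun j => (by fun_prop : Measurable fun q : ℝ × (Fin M → ℝ) =>
      (q.1, q.2 j)) hA
  calc P {ω | ∀ j, (X none ω, X (some j) ω) ∈ A}
      = (P.map fun ω => (X none ω, fun j : Fin M => X (some j) ω))
          {q : ℝ × (Fin M → ℝ) | ∀ j, (q.1, q.2 j) ∈ A} := by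
        rw [Measure.map_apply_of_aemeasurable ((hmeas _).prodMk hjm) hB]; rfl
    _ = ∫⁻ x, ν {y | (x, y) ∈ A} ^ M ∂ν := by
        rw [hjoint, Measure.prod_apply hB]
        refine lintegral_congr fun x => ?_
        have : Prod.mk x ⁻¹' {q : ℝ × (Fin M → ℝ) | ∀ j, (q.1, q.2 j) ∈ A} =
            univ.pi fun _ => {y | (x, y) ∈ A} := by
          ext u; simp
        rw [this, Measure.pi_pi]
        simp

end SGF

/-! ### The probability that one user misses the target -/

namespace SGF

open Set

theorem expMeasure_one_eq_withDensity :
    expMeasure 1 = (volume.restrict (Ici 0)).withDensity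
      fun x => ENNReal.ofReal (Real.exp (-x)) := by
  rw [← withDensity_indicator measurableSet_Ici]
  change volume.withDensity (exponentialPDF 1) = _
  congr 1
  ext x
  rw [exponentialPDF_eq]
  by_cases hx : 0 ≤ x <;> simp [hx]

theorem expMeasure_one_Iio_zero : expMeasure 1 (Iio 0) = 0 := by
  rw [expMeasure_one_eq_withDensity, withDensity_apply _ measurableSet_Iio,
    Measure.restrict_restrict measurableSet_Iio]
  have : Iio (0 : ℝ) ∩ Ici 0 = ∅ := by ext; simp
  simp [this]

theorem expMeasure_one_real_Ico {a b : ℝ} (ha : 0 ≤ a) (hab : a ≤ b) :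
    (expMeasure 1).real (Ico a b) = Real.exp (-a) - Real.exp (-b) := by
  have hsub : Ico a b ∩ Ici 0 = Ico a b :=
    inter_eq_left.2 fun y hy => ha.trans hy.1
  rw [measureReal_def, expMeasure_one_eq_withDensity, withDensity_apply _ measurableSet_Ico,
    Measure.restrict_restrict measurableSet_Ico, hsub, ← ofReal_integral_eq_lintegral_ofReal,
    integral_Ico_eq_integral_Ioc, ← intervalIntegral.integral_of_le hab, ENNReal.toReal_ofReal]
  · rw [intervalIntegral.integral_comp_neg (fun x => Real.exp x), integral_exp]
  · exact intervalIntegral.integral_nonneg hab fun x _ => (Real.exp_pos _).le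
  · exact (Continuous.integrableOn_Icc (by fun_prop)).mono_set Ico_subset_Icc_self
  · exact Filter.Eventually.of_forall fun x => (Real.exp_pos _).le

theorem integral_expMeasure_one (f : ℝ → ℝ) :
    ∫ x, f x ∂expMeasure 1 = ∫ x in Ioi 0, f x * Real.exp (-x) := by
  rw [expMeasure_one_eq_withDensity, integral_withDensity_eq_integral_toReal_smul (by fun_prop)
    (by simp), integral_Ici_eq_integral_Ioi]
  refine integral_congr_ae (Filter.Eventually.of_forall fun x => ?_)
  simp [ENNReal.toReal_ofReal (Real.exp_pos _).le, mul_comm]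

theorem expMeasure_one_real_congr {s t : Set ℝ} (h : ∀ y, 0 ≤ y → (y ∈ s ↔ y ∈ t)) :
    (expMeasure 1).real s = (expMeasure 1).real t := by
  refine measureReal_congr ?_
  have : ∀ᵐ y ∂expMeasure 1, 0 ≤ y := by
    rw [ae_iff]
    simpa [Iio] using expMeasure_one_Iio_zero
  filter_upwards [this] with y hy
  exact propext (h y hy)

namespace Params

variable {S : Params}

/-- The survival function of the gain at `τ(x) / P_s`, for `x ≥ α₀`: the probability that a
grant-free user lies in Group 1. -/
def thresholdTail (S : Params) (x : ℝ) : ℝ := Real.exp (1 / S.Ps - x / (S.α₀ * S.Ps))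

/-- The survival function of the gain at `α_s (P₀ x + 1)`, the gain from which the rate `R_{k,II}`
meets the target. -/
def targetTail (S : Params) (x : ℝ) : ℝ := Real.exp (-(S.αs * (S.P₀ * x + 1)))

@[fun_prop]
theorem continuous_thresholdTail : Continuous S.thresholdTail := by
  unfold thresholdTail; fun_prop

@[fun_prop]
theorem continuous_targetTail : Continuous S.targetTail := by
  unfold targetTail; fun_prop

theorem ε₀_pos (hR₀ : 0 < S.R₀) : 0 < S.ε₀ :=
  sub_pos.2 (Real.one_lt_rpow one_lt_two hR₀)

theorem εs_nonneg (hRs : 0 ≤ S.Rs) : 0 ≤ S.εs :=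
  sub_nonneg.2 (Real.one_le_rpow one_le_two hRs)

theorem α₀_pos (hP₀ : 0 < S.P₀) (hR₀ : 0 < S.R₀) : 0 < S.α₀ := div_pos (ε₀_pos hR₀) hP₀

theorem αs_nonneg (hPs : 0 < S.Ps) (hRs : 0 ≤ S.Rs) : 0 ≤ S.αs :=
  div_nonneg (εs_nonneg hRs) hPs.le

theorem α₀_le_α₁ (hP₀ : 0 < S.P₀) (hR₀ : 0 < S.R₀) (hRs : 0 ≤ S.Rs) : S.α₀ ≤ S.α₁ :=
  le_mul_of_one_le_left (α₀_pos hP₀ hR₀).le (by linarith [εs_nonneg hRs])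

theorem α₁_le_α₂ (hP₀ : 0 < S.P₀) (hR₀ : 0 < S.R₀) (hRs : 0 ≤ S.Rs)
    (hε : S.εs * S.ε₀ < 1) : S.α₁ ≤ S.α₂ := by
  have h0 := ε₀_pos hR₀
  have hs := εs_nonneg hRs
  have h1 : 0 < 1 - S.ε₀ * S.εs := by linarith [mul_comm S.εs S.ε₀]
  rw [α₁, α₂, α₀, ← mul_div_assoc, mul_comm (1 + S.εs), add_comm 1 S.εs]
  refine div_le_div_of_nonneg_left (by positivity) (by positivity) ?_
  exact mul_le_of_le_one_left hP₀.le (by nlinarith [mul_nonneg h0.le hs])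

theorem logb_one_add_lt_iff {z : ℝ} (hz : 0 ≤ z) :
    Real.logb 2 (1 + z) < S.Rs ↔ z < S.εs := by
  rw [Real.logb_lt_iff_lt_rpow one_lt_two (by linarith), εs, lt_sub_iff_add_lt, add_comm]

/-- A grant-free user misses the target rate exactly when it lies in Group 2 with gain below `α_s`,
or in Group 1 with gain below `α_s (P₀ x + 1)`. -/
theorem rate_lt_iff (hP₀ : 0 < S.P₀) (hPs : 0 < S.Ps) {x y : ℝ} (hx : 0 ≤ x) (hy : 0 ≤ y) :
    S.rate x y < S.Rs ↔
      (y < S.τ x / S.Ps ∧ y < S.αs) ∨ (S.τ x / S.Ps ≤ y ∧ y < S.αs * (S.P₀ * x + 1)) := by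
  have hd : 0 < S.P₀ * x + 1 := by positivity
  have e1 : S.rateI y < S.Rs ↔ y < S.αs := by
    rw [rateI, logb_one_add_lt_iff (by positivity), αs, lt_div_iff₀ hPs, mul_comm]
  have e2 : S.rateII x y < S.Rs ↔ y < S.αs * (S.P₀ * x + 1) := by
    rw [rateII, logb_one_add_lt_iff (by positivity), αs, div_lt_iff₀ hd, div_mul_eq_mul_div,
      lt_div_iff₀ hPs, mul_comm S.Ps]
  have e3 : S.Ps * y < S.τ x ↔ y < S.τ x / S.Ps := by rw [lt_div_iff₀ hPs, mul_comm]
  unfold rate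
  split_ifs with h
  · have h' := e3.1 h
    simp [e1, h', h'.not_ge]
  · have h' := not_lt.1 (mt e3.2 h)
    simp [e2, h', h'.not_gt]

theorem τ_eq (x : ℝ) : S.τ x = max 0 (x / S.α₀ - 1) := by
  rw [τ, α₀, div_div_eq_mul_div, mul_comm x]; rfl

theorem τ_eq_of_le (hP₀ : 0 < S.P₀) (hR₀ : 0 < S.R₀) {x : ℝ} (hx : S.α₀ ≤ x) :
    S.τ x = x / S.α₀ - 1 := by
  rw [τ_eq, max_eq_right]
  rw [sub_nonneg, one_le_div (α₀_pos hP₀ hR₀)]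
  exact hx

theorem exp_neg_τ_div (hP₀ : 0 < S.P₀) (hPs : 0 < S.Ps) (hR₀ : 0 < S.R₀) {x : ℝ}
    (hx : S.α₀ ≤ x) : Real.exp (-(S.τ x / S.Ps)) = S.thresholdTail x := by
  have := α₀_pos hP₀ hR₀
  rw [thresholdTail, τ_eq_of_le hP₀ hR₀ hx]
  congr 1
  field_simp
  ring

theorem τ_le_εs_iff (hP₀ : 0 < S.P₀) (hR₀ : 0 < S.R₀) (hRs : 0 ≤ S.Rs) (x : ℝ) :
    S.τ x ≤ S.εs ↔ x ≤ S.α₁ := by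
  rw [τ_eq, max_le_iff, and_iff_right (εs_nonneg hRs), sub_le_iff_le_add,
    div_le_iff₀ (α₀_pos hP₀ hR₀), α₁, add_comm]

theorem τ_le_εs_mul_iff (hP₀ : 0 < S.P₀) (hR₀ : 0 < S.R₀) (hRs : 0 ≤ S.Rs)
    (hε : S.εs * S.ε₀ < 1) {x : ℝ} (hx : 0 ≤ x) :
    S.τ x ≤ S.εs * (S.P₀ * x + 1) ↔ x ≤ S.α₂ := by
  have h0 := ε₀_pos hR₀
  have hs := εs_nonneg hRs
  have h1 : 0 < 1 - S.ε₀ * S.εs := by linarith [mul_comm S.εs S.ε₀]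
  rw [τ_eq, max_le_iff, and_iff_right (by positivity), sub_le_iff_le_add, α₀,
    div_div_eq_mul_div, div_le_iff₀ h0, α₂, le_div_iff₀ (by positivity)]
  constructor <;> intro h <;> nlinarith

/-- The probability that a single grant-free user misses the target rate, given that the gain of
the grant-based user is `x`. -/
def missProb (S : Params) (x : ℝ) : ℝ := (expMeasure 1).real {y | S.rate x y < S.Rs}

theorem missProb_of_le_α₁ (hP₀ : 0 < S.P₀) (hPs : 0 < S.Ps) (hR₀ : 0 < S.R₀) (hRs : 0 ≤ S.Rs)
    {x : ℝ} (hx : 0 ≤ x) (hx₁ : x ≤ S.α₁) : S.missProb x = 1 - S.targetTail x := by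
  have hs := αs_nonneg hPs hRs
  have hτ : S.τ x / S.Ps ≤ S.αs :=
    div_le_div_of_nonneg_right ((τ_le_εs_iff hP₀ hR₀ hRs x).2 hx₁) hPs.le
  have hle : S.αs ≤ S.αs * (S.P₀ * x + 1) :=
    le_mul_of_one_le_right hs (by nlinarith)
  -- Since `τ(x) / P_s ≤ α_s`, the gains that fail in Group 2 and those that fail in Group 1 are
  -- adjacent intervals.
  rw [missProb, expMeasure_one_real_congr (t := Ico 0 (S.αs * (S.P₀ * x + 1))),
    expMeasure_one_real_Ico le_rfl (hs.trans hle)]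
  · simp [targetTail]
  · intro y hy
    rw [mem_ofPred_eq, rate_lt_iff hP₀ hPs hx hy, mem_Ico, and_iff_right hy]
    constructor
    · rintro (h | h)
      · linarith [h.2]
      · exact h.2
    · intro h
      rcases lt_or_ge y (S.τ x / S.Ps) with h' | h'
      · exact Or.inl ⟨h', h'.trans_le hτ⟩
      · exact Or.inr ⟨h', h⟩

theorem missProb_of_mem_Icc (hP₀ : 0 < S.P₀) (hPs : 0 < S.Ps) (hR₀ : 0 < S.R₀) (hRs : 0 ≤ S.Rs)
    (hε : S.εs * S.ε₀ < 1) {x : ℝ} (hx₁ : S.α₁ ≤ x) (hx₂ : x ≤ S.α₂) :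
    S.missProb x = (1 - Real.exp (-S.αs)) + (S.thresholdTail x - S.targetTail x) := by
  have := isProbabilityMeasure_expMeasure one_pos
  have hs := αs_nonneg hPs hRs
  have hx₀ : S.α₀ ≤ x := (α₀_le_α₁ hP₀ hR₀ hRs).trans hx₁
  have hx : 0 ≤ x := (α₀_pos hP₀ hR₀).le.trans hx₀
  have hτ : S.αs ≤ S.τ x / S.Ps := by
    refine div_le_div_of_nonneg_right ?_ hPs.le
    have h0 := α₀_pos hP₀ hR₀
    rw [τ_eq_of_le hP₀ hR₀ hx₀, le_sub_iff_add_le, le_div_iff₀ h0]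
    rw [α₁] at hx₁
    linarith
  have hle : S.τ x / S.Ps ≤ S.αs * (S.P₀ * x + 1) := by
    rw [αs, div_mul_eq_mul_div]
    exact div_le_div_of_nonneg_right ((τ_le_εs_mul_iff hP₀ hR₀ hRs hε hx).2 hx₂) hPs.le
  -- Gains between `α_s` and `τ(x) / P_s` meet the target in Group 2.
  rw [missProb, expMeasure_one_real_congr
      (t := Ico 0 S.αs ∪ Ico (S.τ x / S.Ps) (S.αs * (S.P₀ * x + 1))),
    measureReal_union _ measurableSet_Ico, expMeasure_one_real_Ico le_rfl hs,
    expMeasure_one_real_Ico (hs.trans hτ) hle, exp_neg_τ_div hP₀ hPs hR₀ hx₀]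
  · simp [targetTail]
  · exact Set.disjoint_left.2 fun y hy hy' => (hy.2.trans_le (hτ.trans hy'.1)).false
  · intro y hy
    rw [mem_ofPred_eq, rate_lt_iff hP₀ hPs hx hy, mem_union, mem_Ico, mem_Ico, and_iff_right hy]
    refine or_congr_left ⟨fun h => h.2, fun h => ⟨h.trans_le hτ, h⟩⟩

theorem missProb_of_α₂_lt (hP₀ : 0 < S.P₀) (hPs : 0 < S.Ps) (hR₀ : 0 < S.R₀) (hRs : 0 ≤ S.Rs)
    (hε : S.εs * S.ε₀ < 1) {x : ℝ} (hx₂ : S.α₂ < x) :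
    S.missProb x = 1 - Real.exp (-S.αs) := by
  have hs := αs_nonneg hPs hRs
  have hx : 0 ≤ x := (α₀_pos hP₀ hR₀).le.trans
    (((α₀_le_α₁ hP₀ hR₀ hRs).trans (α₁_le_α₂ hP₀ hR₀ hRs hε)).trans hx₂.le)
  have hlt : S.αs * (S.P₀ * x + 1) < S.τ x / S.Ps := by
    rw [αs, div_mul_eq_mul_div]
    exact div_lt_div_of_pos_right
      (lt_of_not_ge (mt (τ_le_εs_mul_iff hP₀ hR₀ hRs hε hx).1 hx₂.not_ge)) hPs
  have hle : S.αs ≤ S.αs * (S.P₀ * x + 1) :=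
    le_mul_of_one_le_right hs (by nlinarith)
  -- Every gain in Group 1 meets the target, because the threshold exceeds `α_s (P₀ x + 1)`.
  rw [missProb, expMeasure_one_real_congr (t := Ico 0 S.αs), expMeasure_one_real_Ico le_rfl hs]
  · simp
  · intro y hy
    rw [mem_ofPred_eq, rate_lt_iff hP₀ hPs hx hy, mem_Ico, and_iff_right hy]
    constructor
    · rintro (h | h)
      · exact h.2
      · linarith [h.1, h.2]
    · exact fun h => Or.inl ⟨by linarith, h⟩

/-- The mean of the `M`-th power of `missProb`, split at `α₀`, `α₁`, `α₂`. -/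
theorem integral_missProb_pow (hP₀ : 0 < S.P₀) (hPs : 0 < S.Ps) (hR₀ : 0 < S.R₀)
    (hRs : 0 ≤ S.Rs) (hε : S.εs * S.ε₀ < 1) (M : ℕ) :
    ∫ x, S.missProb x ^ M ∂expMeasure 1 =
      (∫ x in 0..S.α₀, (1 - S.targetTail x) ^ M * Real.exp (-x))
      + (∫ x in S.α₀..S.α₁, (1 - S.targetTail x) ^ M * Real.exp (-x))
      + (∫ x in S.α₁..S.α₂, ((1 - Real.exp (-S.αs)) + (S.thresholdTail x - S.targetTail x)) ^ M
          * Real.exp (-x))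
      + (1 - Real.exp (-S.αs)) ^ M * Real.exp (-S.α₂) := by
  have h0 := α₀_pos hP₀ hR₀
  have h01 := α₀_le_α₁ hP₀ hR₀ hRs
  have h12 := α₁_le_α₂ hP₀ hR₀ hRs hε
  set f : ℝ → ℝ := fun x => S.missProb x ^ M * Real.exp (-x) with hf
  have c1 : EqOn f (fun x => (1 - S.targetTail x) ^ M * Real.exp (-x)) (Icc 0 S.α₁) :=
    fun x hx => by simp only [hf, missProb_of_le_α₁ hP₀ hPs hR₀ hRs hx.1 hx.2]
  have c2 : EqOn f (fun x => ((1 - Real.exp (-S.αs)) +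
      (S.thresholdTail x - S.targetTail x)) ^ M * Real.exp (-x)) (Icc S.α₁ S.α₂) :=
    fun x hx => by simp only [hf, missProb_of_mem_Icc hP₀ hPs hR₀ hRs hε hx.1 hx.2]
  have c3 : EqOn f (fun x => (1 - Real.exp (-S.αs)) ^ M * Real.exp (-x)) (Ioi S.α₂) :=
    fun x hx => by simp only [hf, missProb_of_α₂_lt hP₀ hPs hR₀ hRs hε hx]
  have s1 : uIcc 0 S.α₁ = Icc 0 S.α₁ := uIcc_of_le (h0.le.trans h01)
  have s2 : uIcc S.α₁ S.α₂ = Icc S.α₁ S.α₂ := uIcc_of_le h12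
  have s3 : uIcc 0 S.α₀ ⊆ Icc 0 S.α₁ := uIcc_of_le h0.le ▸ Icc_subset_Icc_right h01
  have s4 : uIcc S.α₀ S.α₁ ⊆ Icc 0 S.α₁ := uIcc_of_le h01 ▸ Icc_subset_Icc_left h0.le
  have i1 : IntervalIntegrable f volume 0 S.α₁ :=
    (Continuous.intervalIntegrable (by fun_prop) _ _).congr
      (fun x hx => (c1 (s1 ▸ uIoc_subset_uIcc hx)).symm)
  have i2 : IntervalIntegrable f volume S.α₁ S.α₂ :=
    (Continuous.intervalIntegrable (by fun_prop) _ _).congr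
      (fun x hx => (c2 (s2 ▸ uIoc_subset_uIcc hx)).symm)
  have i3 : IntegrableOn f (Ioi S.α₂) :=
    IntegrableOn.congr_fun (Integrable.const_mul (integrableOn_exp_neg_Ioi S.α₂) _) c3.symm
      measurableSet_Ioi
  have i12 := i1.trans i2
  have i0 : IntervalIntegrable f volume 0 S.α₀ := i1.mono_set (s1 ▸ s3)
  have i01 : IntervalIntegrable f volume S.α₀ S.α₁ := i1.mono_set (s1 ▸ s4)
  rw [integral_expMeasure_one, ← intervalIntegral.integral_interval_add_Ioi' i12 i3,
    ← intervalIntegral.integral_add_adjacent_intervals i1 i2,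
    ← intervalIntegral.integral_add_adjacent_intervals i0 i01,
    intervalIntegral.integral_congr (c1.mono s3), intervalIntegral.integral_congr (c1.mono s4),
    intervalIntegral.integral_congr (c2.mono s2.subset), setIntegral_congr_fun measurableSet_Ioi c3,
    integral_const_mul, integral_exp_neg_Ioi]

end Params
end SGF

/-! ### Binomial expansion of the integrals -/

namespace SGF
open Set

/-- Binomial expansion of both powers, under the integral sign. -/
theorem sum_choose_mul_integral {u a b w : ℝ → ℝ} (hu : Continuous u) (ha : Continuous a)
    (hb : Continuous b) (hw : Continuous w) (m n : ℕ) (s t : ℝ) :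
    ∑ l ∈ Finset.range (n + 1), (n.choose l : ℝ) * (-1) ^ l *
      ∑ p ∈ Finset.range (m + 1), (m.choose p : ℝ) * (-1) ^ p *
        ∫ x in s..t, b x ^ l * a x ^ (n - l) * u x ^ p * w x =
      ∫ x in s..t, (1 - u x) ^ m * (a x - b x) ^ n * w x := by
  have e : ∀ x y : ℝ, ∀ k : ℕ, (x - y) ^ k =
      ∑ l ∈ Finset.range (k + 1), (k.choose l : ℝ) * (-1) ^ l * (y ^ l * x ^ (k - l)) := by
    intro x y k
    rw [sub_eq_neg_add, add_pow]
    refine Finset.sum_congr rfl fun l _ => ?_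
    rw [neg_pow]; ring
  simp_rw [← intervalIntegral.integral_const_mul]
  have hint : ∀ l p : ℕ, IntervalIntegrable (fun x => (m.choose p : ℝ) * (-1) ^ p *
      (b x ^ l * a x ^ (n - l) * u x ^ p * w x)) volume s t :=
    fun l p => Continuous.intervalIntegrable (by fun_prop) _ _
  have h1 : ∀ l, ∑ p ∈ Finset.range (m + 1), ∫ x in s..t, (m.choose p : ℝ) * (-1) ^ p *
      (b x ^ l * a x ^ (n - l) * u x ^ p * w x) = ∫ x in s..t, ∑ p ∈ Finset.range (m + 1),
        (m.choose p : ℝ) * (-1) ^ p * (b x ^ l * a x ^ (n - l) * u x ^ p * w x) :=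
    fun l => (intervalIntegral.integral_finsetSum fun p _ => hint l p).symm
  simp_rw [h1, ← intervalIntegral.integral_const_mul]
  rw [← intervalIntegral.integral_finsetSum
    fun l _ => Continuous.intervalIntegrable (by fun_prop) _ _]
  refine intervalIntegral.integral_congr fun x _ => ?_
  rw [e 1 (u x) m, e (a x) (b x) n, mul_comm (Finset.sum _ _), mul_assoc, Finset.sum_mul]
  refine Finset.sum_congr rfl fun l _ => ?_
  rw [Finset.sum_mul, Finset.mul_sum, Finset.mul_sum]
  refine Finset.sum_congr rfl fun p _ => ?_
  rw [one_pow]; ring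

namespace Params
variable {S : Params}

theorem gAux_eq_integral {μ : ℝ} (hμ : 1 + μ ≠ 0) (s t : ℝ) :
    gAux μ s t = ∫ x in s..t, Real.exp (-(1 + μ) * x) := by
  rw [intervalIntegral.integral_comp_mul_left (fun x => Real.exp x) (neg_ne_zero.2 hμ),
    integral_exp, gAux, smul_eq_mul]
  field_simp
  ring

/-- A product of tails is an exponential in `x`; its rate and its value at `0` are the quantities
`μ̃₂` and `μ̃₄` of the closed form when `q = M - m - l`. -/
theorem tails_mul_exp (hP₀ : 0 < S.P₀) (hPs : 0 < S.Ps) (hR₀ : 0 < S.R₀) (l q : ℕ) (x : ℝ) :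
    S.targetTail x ^ l * S.thresholdTail x ^ q * Real.exp (-x) =
      Real.exp (-l * S.αs + q * (1 / S.Ps)) *
        Real.exp (-(1 + (l * S.αs * S.P₀ + q * (S.α₀⁻¹ / S.Ps))) * x) := by
  have := α₀_pos hP₀ hR₀
  rw [targetTail, thresholdTail, ← Real.exp_nat_mul, ← Real.exp_nat_mul, ← Real.exp_add,
    ← Real.exp_add, ← Real.exp_add]
  congr 1
  field_simp
  ring

theorem exp_mul_gAux (hP₀ : 0 < S.P₀) (hPs : 0 < S.Ps) (hR₀ : 0 < S.R₀) (hRs : 0 ≤ S.Rs)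
    (l q : ℕ) (s t : ℝ) :
    Real.exp (-l * S.αs + q * (1 / S.Ps)) *
        gAux (l * S.αs * S.P₀ + q * (S.α₀⁻¹ / S.Ps)) s t =
      ∫ x in s..t, S.targetTail x ^ l * S.thresholdTail x ^ q * Real.exp (-x) := by
  have := α₀_pos hP₀ hR₀
  have := αs_nonneg hPs hRs
  rw [gAux_eq_integral (by positivity), ← intervalIntegral.integral_const_mul]
  exact intervalIntegral.integral_congr fun x _ => (tails_mul_exp hP₀ hPs hR₀ l q x).symm

theorem ε₀_inv_mul : S.ε₀⁻¹ * S.P₀ = S.α₀⁻¹ := by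
  rw [α₀, inv_div, inv_mul_eq_div]

theorem μ₄_mul_phi (hP₀ : 0 < S.P₀) (hPs : 0 < S.Ps) (hR₀ : 0 < S.R₀) (hRs : 0 ≤ S.Rs)
    {M m l : ℕ} (hml : m + l ≤ M) (p : ℕ) :
    S.μ₄ M m l * S.phi p (S.μ₂ M m l) =
      (∫ x in S.α₀..S.α₁, S.targetTail x ^ l * S.thresholdTail x ^ (M - m - l) *
        S.thresholdTail x ^ p * Real.exp (-x))
      + ∫ x in S.α₁..S.α₂, S.targetTail x ^ l * S.thresholdTail x ^ (M - m - l) *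
        Real.exp (-S.αs) ^ p * Real.exp (-x) := by
  have h0 := α₀_pos hP₀ hR₀
  obtain ⟨q, rfl⟩ := Nat.exists_eq_add_of_le hml
  have hq : m + l + q - m - l = q := by omega
  have hqc : ((m + l + q : ℕ) : ℝ) - m - l = q := by push_cast; ring
  have e1 := exp_mul_gAux hP₀ hPs hR₀ hRs l (q + p) S.α₀ S.α₁
  have e2 := exp_mul_gAux hP₀ hPs hR₀ hRs l q S.α₁ S.α₂
  have i2 : (∫ x in S.α₁..S.α₂, S.targetTail x ^ l * S.thresholdTail x ^ q *
        Real.exp (-S.αs) ^ p * Real.exp (-x)) = Real.exp (-S.αs) ^ p *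
      ∫ x in S.α₁..S.α₂, S.targetTail x ^ l * S.thresholdTail x ^ q * Real.exp (-x) := by
    rw [← intervalIntegral.integral_const_mul]
    exact intervalIntegral.integral_congr fun x _ => by ring
  simp only [hq]
  rw [i2, ← e2]
  simp only [mul_assoc (S.targetTail _ ^ l), ← pow_add] at e1 ⊢
  rw [← e1, μ₄, μ₂, phi, hqc, ε₀_inv_mul]
  have e3 : (l : ℝ) * S.αs * S.P₀ + q * (S.α₀⁻¹ / S.Ps) + p / (S.Ps * S.α₀) =
      l * S.αs * S.P₀ + (q + p : ℕ) * (S.α₀⁻¹ / S.Ps) := by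
    push_cast; field_simp; ring
  have e4 : Real.exp (-l * S.αs + (q + p : ℕ) * (1 / S.Ps)) =
      Real.exp (-l * S.αs + q * (1 / S.Ps)) * Real.exp (p / S.Ps) := by
    rw [← Real.exp_add]; congr 1; push_cast; field_simp; ring
  rw [e3, e4, ← Real.exp_nat_mul, mul_neg, ← neg_mul]
  ring

/-- The probability that everyone misses the target rate while the gain of the grant-based user lies
between `α₀` and `α₂`, exactly `m` given users are in Group 2 and the `M - m` others in Group 1. -/
def groupTerm (S : Params) (M m : ℕ) : ℝ :=
  ∑ l ∈ Finset.range (M - m + 1), ((M - m).choose l : ℝ) * (-1) ^ l *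
    ∑ p ∈ Finset.range (m + 1), (m.choose p : ℝ) * (-1) ^ p *
      (S.μ₄ M m l * S.phi p (S.μ₂ M m l))

theorem groupTerm_eq_integral (hP₀ : 0 < S.P₀) (hPs : 0 < S.Ps) (hR₀ : 0 < S.R₀)
    (hRs : 0 ≤ S.Rs) {M m : ℕ} (hm : m ≤ M) :
    S.groupTerm M m =
      (∫ x in S.α₀..S.α₁, (1 - S.thresholdTail x) ^ m *
        (S.thresholdTail x - S.targetTail x) ^ (M - m) * Real.exp (-x))
      + ∫ x in S.α₁..S.α₂, (1 - Real.exp (-S.αs)) ^ m *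
        (S.thresholdTail x - S.targetTail x) ^ (M - m) * Real.exp (-x) := by
  rw [← sum_choose_mul_integral (u := S.thresholdTail) (a := S.thresholdTail)
      (b := S.targetTail) (w := fun x => Real.exp (-x)) (by fun_prop) (by fun_prop)
      (by fun_prop) (by fun_prop),
    ← sum_choose_mul_integral (u := fun _ => Real.exp (-S.αs)) (a := S.thresholdTail)
      (b := S.targetTail) (w := fun x => Real.exp (-x)) (by fun_prop) (by fun_prop)
      (by fun_prop) (by fun_prop), ← Finset.sum_add_distrib, groupTerm]
  refine Finset.sum_congr rfl fun l hl => ?_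
  rw [← mul_add, ← Finset.sum_add_distrib]
  congr 1
  refine Finset.sum_congr rfl fun p _ => ?_
  have := Finset.mem_range.1 hl
  rw [μ₄_mul_phi hP₀ hPs hR₀ hRs (by omega), mul_add]

theorem ηbar_eq {M m : ℕ} (hm : m ≤ M) : ηbar M m = M.choose m := by
  rw [ηbar, Nat.cast_choose ℝ hm]

theorem ηtilde_eq {M : ℕ} (hM : 2 ≤ M) : ηtilde M = M * (M - 1) := by
  obtain ⟨n, rfl⟩ := Nat.exists_eq_add_of_le' hM
  rw [ηtilde, Nat.add_sub_cancel, div_eq_iff (by positivity), Nat.factorial_succ,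
    Nat.factorial_succ]
  push_cast; ring

theorem groupTerm_zero (M : ℕ) :
    S.groupTerm M 0 = ∑ l ∈ Finset.range (M + 1), (-1) ^ l * (M.choose l : ℝ) *
      Real.exp (-l * S.αs) * Real.exp (((M : ℝ) - l) / S.Ps) *
        gAux (S.μ₁₂ M l) S.α₀ S.α₂ := by
  refine Finset.sum_congr rfl fun l _ => ?_
  have h : S.phi 0 (S.μ₂ M 0 l) = gAux (S.μ₁₂ M l) S.α₀ S.α₂ := by
    simp only [phi, gAux, μ₂, μ₁₂, ε₀_inv_mul]
    simp only [CharP.cast_eq_zero, neg_zero, zero_mul, Real.exp_zero, zero_div, add_zero, one_mul,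
      sub_zero]
    ring
  rw [Finset.sum_range_one, h, μ₄, Real.exp_add]
  simp only [Nat.sub_zero, Nat.choose_self, CharP.cast_eq_zero, sub_zero, pow_zero]
  rw [mul_one_div]
  push_cast
  ring

theorem groupTerm_pred {M : ℕ} (hM : 2 ≤ M) :
    S.groupTerm M (M - 1) = ∑ i ∈ Finset.range M, ((M - 1).choose i : ℝ) * (-1) ^ i *
      (Real.exp (1 / S.Ps) * S.phi i S.μ₇ - Real.exp (-S.αs) * S.phi i S.μ₈) := by
  obtain ⟨n, rfl⟩ := Nat.exists_eq_add_of_le' hM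
  have e1 : n + 2 - 1 = n + 1 := rfl
  have e2 : n + 2 - (n + 1) = 1 := by omega
  have e3 : ((n + 2 : ℕ) : ℝ) - (n + 1 : ℕ) = 1 := by push_cast; ring
  rw [groupTerm, e1, e2, Finset.sum_range_succ, Finset.sum_range_one, Finset.mul_sum,
    Finset.mul_sum, ← Finset.sum_add_distrib]
  refine Finset.sum_congr rfl fun p _ => ?_
  simp only [μ₄, μ₂, μ₇, μ₈, e3, ε₀_inv_mul]
  have e4 : S.α₀⁻¹ / S.Ps = 1 / (S.Ps * S.α₀) := by
    rw [one_div, mul_inv, div_eq_inv_mul]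
  simp [e4]
  ring

end Params
end SGF

/-! ### The outage probability -/

namespace SGF
open Set
namespace Params
variable {S : Params}

theorem measurable_rate : Measurable fun p : ℝ × ℝ => S.rate p.1 p.2 := by
  unfold rate rateI rateII τ Real.logb
  refine Measurable.ite (measurableSet_lt ?_ ?_) ?_ ?_ <;> fun_prop

/-- The admitted user has the largest rate, so it misses the target exactly when everyone does. -/
theorem rate_lt_iff_forall_of_isAdmitted {M : ℕ} {g : ℂ} {h : Fin M → ℂ} {k : Fin M}
    (hk : S.IsAdmitted g h k) :
    S.rate (‖g‖ ^ 2) (‖h k‖ ^ 2) < S.Rs ↔ ∀ j, S.rate (‖g‖ ^ 2) (‖h j‖ ^ 2) < S.Rs :=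
  ⟨fun H j => (hk j).trans_lt H, fun H => H k⟩

theorem measureReal_forall_rate_lt {Ω : Type*} [MeasurableSpace Ω] {P : Measure Ω}
    [IsProbabilityMeasure P] {M : ℕ} {g : Ω → ℂ} {h : Fin M → Ω → ℂ}
    (hg : HasLaw g complexGaussian P) (hh : ∀ m, HasLaw (h m) complexGaussian P)
    (hind : iIndepFun (fun o : Option (Fin M) => o.elim g h) P) :
    P.real {ω | ∀ j, S.rate (‖g ω‖ ^ 2) (‖h j ω‖ ^ 2) < S.Rs} =
      ∫ x, S.missProb x ^ M ∂expMeasure 1 := by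
  have := isProbabilityMeasure_expMeasure one_pos
  have hm : Measurable (fun z : ℂ => ‖z‖ ^ 2) := by fun_prop
  have hgain : HasLaw (fun z : ℂ => ‖z‖ ^ 2) (expMeasure 1) complexGaussian :=
    ⟨hm.aemeasurable, map_sq_norm_complexGaussian⟩
  have hlaw : ∀ o : Option (Fin M),
      HasLaw (fun ω => ‖o.elim g h ω‖ ^ 2) (expMeasure 1) P := by
    rintro (_ | j)
    · exact hgain.comp hg
    · exact hgain.comp (hh j)
  have hA : MeasurableSet {p : ℝ × ℝ | S.rate p.1 p.2 < S.Rs} :=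
    measurable_rate measurableSet_Iio
  have key := measure_forall_mem_eq_lintegral_pow
    (hind.comp (fun _ z => ‖z‖ ^ 2) fun _ => hm) hlaw hA
  have key' : P {ω | ∀ j, S.rate (‖g ω‖ ^ 2) (‖h j ω‖ ^ 2) < S.Rs} =
      ∫⁻ x, expMeasure 1 {y | S.rate x y < S.Rs} ^ M ∂expMeasure 1 := key
  rw [measureReal_def, key', ← integral_toReal]
  · simp only [ENNReal.toReal_pow]; rfl
  · exact ((measurable_measure_prodMk_left hA).pow_const M).aemeasurable
  · exact Filter.Eventually.of_forall fun x => ENNReal.pow_lt_top (measure_lt_top _ _)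

/-- The binomial theorem over the number of users in Group 2, for `α₀ ≤ x ≤ α₂`. -/
theorem sum_choose_mul_groupTerm (hP₀ : 0 < S.P₀) (hPs : 0 < S.Ps) (hR₀ : 0 < S.R₀)
    (hRs : 0 ≤ S.Rs) (M : ℕ) :
    ∑ m ∈ Finset.range (M + 1), (M.choose m : ℝ) * S.groupTerm M m =
      (∫ x in S.α₀..S.α₁, (1 - S.targetTail x) ^ M * Real.exp (-x))
      + ∫ x in S.α₁..S.α₂, ((1 - Real.exp (-S.αs)) +
          (S.thresholdTail x - S.targetTail x)) ^ M * Real.exp (-x) := by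
  have key : ∀ u : ℝ → ℝ, Continuous u → ∀ s t : ℝ,
      ∑ m ∈ Finset.range (M + 1), (M.choose m : ℝ) * (∫ x in s..t, u x ^ m *
        (S.thresholdTail x - S.targetTail x) ^ (M - m) * Real.exp (-x)) =
      ∫ x in s..t, (u x + (S.thresholdTail x - S.targetTail x)) ^ M * Real.exp (-x) := by
    intro u hu s t
    simp_rw [← intervalIntegral.integral_const_mul]
    rw [← intervalIntegral.integral_finsetSum
      fun m _ => Continuous.intervalIntegrable (by fun_prop) _ _]
    refine intervalIntegral.integral_congr fun x _ => ?_
    simp only [add_pow, Finset.sum_mul]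
    exact Finset.sum_congr rfl fun m _ => by ring
  have h₁ := key (fun x => 1 - S.thresholdTail x) (by fun_prop) S.α₀ S.α₁
  have h₂ := key (fun _ => 1 - Real.exp (-S.αs)) (by fun_prop) S.α₁ S.α₂
  simp only [sub_add_sub_cancel] at h₁
  rw [← h₁, ← h₂, ← Finset.sum_add_distrib]
  refine Finset.sum_congr rfl fun m hm => ?_
  rw [groupTerm_eq_integral hP₀ hPs hR₀ hRs (Nat.lt_succ_iff.1 (Finset.mem_range.1 hm)), mul_add]

theorem groupTerm_self (hP₀ : 0 < S.P₀) (hPs : 0 < S.Ps) (hR₀ : 0 < S.R₀)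
    (hRs : 0 ≤ S.Rs) (M : ℕ) :
    S.groupTerm M M = ∑ i ∈ Finset.range (M + 1), (M.choose i : ℝ) * (-1) ^ i *
        Real.exp (i / S.Ps) * gAux (i / (S.α₀ * S.Ps)) S.α₀ S.α₁
      + (1 - Real.exp (-S.αs)) ^ M * (Real.exp (-S.α₁) - Real.exp (-S.α₂)) := by
  have h0 := α₀_pos hP₀ hR₀
  rw [groupTerm_eq_integral hP₀ hPs hR₀ hRs le_rfl, Nat.sub_self]
  congr 1
  · have h := sum_choose_mul_integral (u := S.thresholdTail) (a := S.thresholdTail)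
      (b := S.targetTail) (w := fun x => Real.exp (-x)) (by fun_prop) (by fun_prop)
      (by fun_prop) (by fun_prop) M 0 S.α₀ S.α₁
    rw [← h, zero_add, Finset.sum_range_one]
    simp only [Nat.choose_self, Nat.cast_one, Nat.sub_self, pow_zero, one_mul]
    refine Finset.sum_congr rfl fun p _ => ?_
    have e := exp_mul_gAux hP₀ hPs hR₀ hRs 0 p S.α₀ S.α₁
    simp only [pow_zero, one_mul] at e
    have e₁ : -((0 : ℕ) : ℝ) * S.αs + p * (1 / S.Ps) = p / S.Ps := by
      simp [div_eq_mul_inv]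
    have e₂ : ((0 : ℕ) : ℝ) * S.αs * S.P₀ + p * (S.α₀⁻¹ / S.Ps) = p / (S.α₀ * S.Ps) := by
      simp only [CharP.cast_eq_zero, zero_mul, zero_add]
      field_simp
    rw [← e, e₁, e₂]
    ring
  · simp only [pow_zero, mul_one]
    rw [intervalIntegral.integral_const_mul,
      intervalIntegral.integral_comp_neg (fun x => Real.exp x), integral_exp]

theorem integral_targetTail_pow (hP₀ : 0 < S.P₀) (hPs : 0 < S.Ps) (hR₀ : 0 < S.R₀)
    (hRs : 0 ≤ S.Rs) (M : ℕ) :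
    ∫ x in 0..S.α₀, (1 - S.targetTail x) ^ M * Real.exp (-x) =
      ∑ i ∈ Finset.range (M + 1), (M.choose i : ℝ) * (-1) ^ i * Real.exp (-i * S.αs) *
          ((1 - Real.exp (-(1 + i * S.αs * S.P₀) * S.α₀)) / (1 + i * S.αs * S.P₀)) := by
  have h := sum_choose_mul_integral (u := S.targetTail) (a := S.targetTail)
      (b := S.targetTail) (w := fun x => Real.exp (-x)) (by fun_prop) (by fun_prop)
      (by fun_prop) (by fun_prop) M 0 0 S.α₀
  simp only [zero_add, Finset.sum_range_one, Nat.choose_self, Nat.cast_one, pow_zero, one_mul,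
    mul_one, Nat.sub_self] at h
  rw [← h]
  refine Finset.sum_congr rfl fun i _ => ?_
  have e := exp_mul_gAux hP₀ hPs hR₀ hRs i 0 0 S.α₀
  simp only [pow_zero, mul_one] at e
  rw [← e]
  simp [gAux, mul_assoc]

/-- The closed form, in terms of the contributions of the numbers of users in Group 2. -/
theorem sum_choose_mul_groupTerm_eq {M : ℕ} (hM : 2 ≤ M) :
    ∑ m ∈ Finset.range (M + 1), (M.choose m : ℝ) * S.groupTerm M m =
      ∑ m ∈ Finset.Icc 1 (M - 2), ηbar M m * S.groupTerm M m
      + ηtilde M / ((M : ℝ) - 1) * S.groupTerm M (M - 1)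
      + ηtilde M / ((M : ℝ) * ((M : ℝ) - 1)) * S.groupTerm M 0
      + S.groupTerm M M := by
  obtain ⟨n, rfl⟩ := Nat.exists_eq_add_of_le' hM
  have hn : (n : ℝ) + 2 - 1 ≠ 0 := by have : (0 : ℝ) ≤ n := n.cast_nonneg; linarith
  have hn' : (n : ℝ) + 2 ≠ 0 := by positivity
  have e1 : ∑ m ∈ Finset.Icc 1 n, ηbar (n + 2) m * S.groupTerm (n + 2) m =
      ∑ m ∈ Finset.range n, ((n + 2).choose (m + 1) : ℝ) * S.groupTerm (n + 2) (m + 1) := by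
    rw [Finset.range_eq_Ico, Finset.sum_Ico_add' (fun m => ((n + 2).choose m : ℝ) *
      S.groupTerm (n + 2) m) 0 n 1, zero_add]
    refine Finset.sum_congr rfl fun m hm => ?_
    rw [ηbar_eq (by have := (Finset.mem_Icc.1 hm).2; omega)]
  rw [Finset.sum_range_succ, Finset.sum_range_succ, Finset.sum_range_succ', Nat.add_sub_cancel,
    e1, ηtilde_eq hM, Nat.choose_self, Nat.choose_zero_right,
    show n + 2 - 1 = n + 1 from rfl, show n + 2 = (n + 1) + 1 from rfl,
    Nat.choose_succ_self_right]
  push_cast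
  rw [show (n : ℝ) + 1 + 1 = n + 2 by ring]
  field_simp
  ring

end Params
end SGF

end

theorem theorem1 {Ω : Type*} [MeasurableSpace Ω] (P : Measure Ω) [IsProbabilityMeasure P]
    (S : SGF.Params) (hP₀ : 0 < S.P₀) (hPs : 0 < S.Ps) (hR₀ : 0 < S.R₀) (hRs : 0 ≤ S.Rs)
    (hε : S.εs * S.ε₀ < 1) (M : ℕ) (hM : 2 ≤ M)
    -- the channel coefficients: independent, each with law `CN(0,1)`
    (g : Ω → ℂ) (h : Fin M → Ω → ℂ)
    (hg : HasLaw g SGF.complexGaussian P) (hh : ∀ m, HasLaw (h m) SGF.complexGaussian P)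
    (hind : iIndepFun (fun o : Option (Fin M) => o.elim g h) P)
    -- the grant-free user admitted by the scheme
    (k : Ω → Fin M) (hk : ∀ᵐ ω ∂P, S.IsAdmitted (g ω) (fun m => h m ω) (k ω)) :
    P.real {ω | S.rate (‖g ω‖ ^ 2) (‖h (k ω) ω‖ ^ 2) < S.Rs} =
      ∑ m ∈ Finset.Icc 1 (M - 2), SGF.Params.ηbar M m *
        ∑ l ∈ Finset.range (M - m + 1), ((M - m).choose l : ℝ) * (-1) ^ l *
          ∑ p ∈ Finset.range (m + 1), (m.choose p : ℝ) * (-1) ^ p *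
            (S.μ₄ M m l * S.phi p (S.μ₂ M m l))
      + ∑ i ∈ Finset.range M, ((M - 1).choose i : ℝ) *
          ((-1) ^ i * SGF.Params.ηtilde M / ((M : ℝ) - 1)) *
            (Real.exp (1 / S.Ps) * S.phi i S.μ₇ - Real.exp (-S.αs) * S.phi i S.μ₈)
      + SGF.Params.ηtilde M / ((M : ℝ) * ((M : ℝ) - 1)) *
          ∑ l ∈ Finset.range (M + 1), (-1) ^ l * (M.choose l : ℝ) * Real.exp (-l * S.αs) *
            Real.exp (((M : ℝ) - l) / S.Ps) * SGF.Params.gAux (S.μ₁₂ M l) S.α₀ S.α₂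
      + ∑ i ∈ Finset.range (M + 1), (M.choose i : ℝ) * (-1) ^ i * Real.exp (i / S.Ps) *
          SGF.Params.gAux (i / (S.α₀ * S.Ps)) S.α₀ S.α₁
      + (1 - Real.exp (-S.αs)) ^ M * Real.exp (-S.α₁)
      + ∑ i ∈ Finset.range (M + 1), (M.choose i : ℝ) * (-1) ^ i * Real.exp (-i * S.αs) *
          ((1 - Real.exp (-(1 + i * S.αs * S.P₀) * S.α₀)) / (1 + i * S.αs * S.P₀)) := by
  have hae : {ω | S.rate (‖g ω‖ ^ 2) (‖h (k ω) ω‖ ^ 2) < S.Rs} =ᵐ[P]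
      {ω | ∀ j, S.rate (‖g ω‖ ^ 2) (‖h j ω‖ ^ 2) < S.Rs} := by
    filter_upwards [hk] with ω hω
    exact propext (SGF.Params.rate_lt_iff_forall_of_isAdmitted hω)
  have hsum := SGF.Params.sum_choose_mul_groupTerm hP₀ hPs hR₀ hRs M
  rw [SGF.Params.sum_choose_mul_groupTerm_eq hM, SGF.Params.groupTerm_self hP₀ hPs hR₀ hRs,
    SGF.Params.groupTerm_pred hM, SGF.Params.groupTerm_zero] at hsum
  have hpull : ∑ i ∈ Finset.range M, ((M - 1).choose i : ℝ) *
          ((-1) ^ i * SGF.Params.ηtilde M / ((M : ℝ) - 1)) *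
            (Real.exp (1 / S.Ps) * S.phi i S.μ₇ - Real.exp (-S.αs) * S.phi i S.μ₈) =
      SGF.Params.ηtilde M / ((M : ℝ) - 1) * ∑ i ∈ Finset.range M,
        ((M - 1).choose i : ℝ) * (-1) ^ i *
          (Real.exp (1 / S.Ps) * S.phi i S.μ₇ - Real.exp (-S.αs) * S.phi i S.μ₈) := by
    rw [Finset.mul_sum]
    exact Finset.sum_congr rfl fun i _ => by ring
  rw [measureReal_congr hae, SGF.Params.measureReal_forall_rate_lt hg hh hind,
    SGF.Params.integral_missProb_pow hP₀ hPs hR₀ hRs hε,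
    SGF.Params.integral_targetTail_pow hP₀ hPs hR₀ hRs, hpull]
  simp only [SGF.Params.groupTerm] at hsum
  linarith
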